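/- For density matrices $\rho,\sigma$ (positive semidefinite, unit trace) let $F(\rho,\sigma):=\|\sqrt{\rho}\sqrt{\sigma}\|_1$ be the (square root) Uhlmann fidelity, where $\|A\|_1:=\mathrm{tr}\sqrt{A^\dagger A}$. Let $\mathcal D_1,\mathcal D_2$ be finite sets of density matrices on a $d$-dimensional Hilbert space, with $|\mathcal D_i|=m_i<\infty$ for $i=1,2$, and put $F_{\max}:=\sup_{\rho_1\in\mathcal D_1,\,\rho_2\in\mathcal D_2}F(\rho_1,\rho_2)$. For $n\in\mathbb N$ let $\mathcal C_{i,n}:=\mathrm{conv}\{\rho^{\otimes n}:\rho\in\mathcal D_i\}$ be the convex hull of the $n$-fold tensor powers of the elements of $\mathcal D_i$. Then every $\sigma_{1,n}\in\mathcal C_{1,n}$ and $\sigma_{2,n}\in\mathcal C_{2,n}$ satisfy $F(\sigma_{1,n},\sigma_{2,n})\le\sqrt{m_1m_2}\,F_{\max}^n$; that is, $$\sup_{\sigma_{1,n}\in\mathcal C_{1,n},\ \sigma_{2,n}\in\mathcal C_{2,n}}F(\sigma_{1,n},\sigma_{2,n})\le\sqrt{m_1m_2}\,F_{\max}^n .$$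 -/

import Mathlib

open scoped Matrix MatrixOrder ComplexOrder

namespace QState

/-- A density matrix: positive semidefinite (in particular Hermitian) with unit trace. -/
def IsDensityMatrix {ι : Type*} [Fintype ι] (ρ : Matrix ι ι ℂ) : Prop :=
  ρ.PosSemidef ∧ ρ.trace = 1

/-- The trace norm `‖A‖₁ = tr √(A† A)`. The trace is that of a positive semidefinite matrix, hence
a nonnegative real number, and its real part is taken only to land in `ℝ`. -/
noncomputable def traceNorm {ι : Type*} [Fintype ι] [DecidableEq ι] (A : Matrix ι ι ℂ) : ℝ :=
  (CFC.sqrt (Aᴴ * A)).trace.re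

/-- The (square root) Uhlmann fidelity `F(ρ, σ) = ‖√ρ √σ‖₁`. -/
noncomputable def fidelity {ι : Type*} [Fintype ι] [DecidableEq ι] (ρ σ : Matrix ι ι ℂ) : ℝ :=
  traceNorm (CFC.sqrt ρ * CFC.sqrt σ)

/-- The `n`-fold tensor (Kronecker) power of a matrix on `ℂ^d`, acting on `(ℂ^d)^{⊗ n}`, whose
product basis is indexed by the words `Fin n → Fin d`. -/
def tensorPow {d : ℕ} (n : ℕ) (ρ : Matrix (Fin d) (Fin d) ℂ) :
    Matrix (Fin n → Fin d) (Fin n → Fin d) ℂ :=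
  Matrix.of fun a b => ∏ k, ρ (a k) (b k)

/-- The set `{ρ^{⊗ n} : ρ ∈ D}` of `n`-fold copies of the states in `D`. -/
def copies {d : ℕ} (n : ℕ) (D : Set (Matrix (Fin d) (Fin d) ℂ)) :
    Set (Matrix (Fin n → Fin d) (Fin n → Fin d) ℂ) :=
  tensorPow n '' D

/-- The convex hull of the `n`-fold copies of the states in `D`. -/
def mixtures {d : ℕ} (n : ℕ) (D : Set (Matrix (Fin d) (Fin d) ℂ)) :
    Set (Matrix (Fin n → Fin d) (Fin n → Fin d) ℂ) :=
  convexHull ℝ (copies n D)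

/-- The supremum of the fidelity over all pairs of states from two sets. -/
noncomputable def supFidelity {ι : Type*} [Fintype ι] [DecidableEq ι]
    (S T : Set (Matrix ι ι ℂ)) : ℝ :=
  sSup {x : ℝ | ∃ ρ ∈ S, ∃ σ ∈ T, x = fidelity ρ σ}

end QState

/-! For positive semidefinite `ρ`, `F(ρ, σ) = tr √(√σ ρ √σ)`, with `ρ` entering linearly under the
root. Since `tr √·` is subadditive (`trace_sqrt_add_le`) and homogeneous of degree 1/2, `F(∑ pₖ ρₖ,
σ) ≤ ∑ √pₖ F(ρₖ, σ)`, and Cauchy–Schwarz gives `∑ √pₖ ≤ √m`. Symmetry of `F` yields the same factor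
in the other argument, and `F` is multiplicative on tensor powers. -/

namespace QState

/-! ### Trace of the square root, and fidelity of mixtures -/

section Trace

theorem posDef_add_smul_one {ι : Type*} [DecidableEq ι] {A : Matrix ι ι ℂ}
    (hA : A.PosSemidef) {ε : ℝ} (hε : 0 < ε) : (A + (ε : ℂ) • 1).PosDef := by
  refine Matrix.PosDef.posSemidef_add hA (Matrix.PosDef.one.smul ?_)
  exact_mod_cast hε

variable {ι : Type*} [Fintype ι] [DecidableEq ι]

theorem posSemidef_sqrt (A : Matrix ι ι ℂ) : (CFC.sqrt A).PosSemidef :=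
  Matrix.nonneg_iff_posSemidef.mp (CFC.sqrt_nonneg A)

theorem sqrt_mul_sqrt_of_posSemidef {A : Matrix ι ι ℂ} (hA : A.PosSemidef) :
    CFC.sqrt A * CFC.sqrt A = A :=
  CFC.sqrt_mul_sqrt_self A hA.nonneg

theorem trace_mul_re_nonneg {A B : Matrix ι ι ℂ} (hA : A.PosSemidef) (hB : B.PosSemidef) :
    0 ≤ (A * B).trace.re := by
  have h : ((CFC.sqrt A)ᴴ * B * CFC.sqrt A).PosSemidef := hB.conjTranspose_mul_mul_same _
  rw [(posSemidef_sqrt A).isHermitian.eq] at h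
  have e : (A * B).trace = (CFC.sqrt A * B * CFC.sqrt A).trace := by
    rw [Matrix.trace_mul_comm (CFC.sqrt A * B), ← Matrix.mul_assoc,
      sqrt_mul_sqrt_of_posSemidef hA]
  rw [e]
  exact (Complex.nonneg_iff.mp h.trace_nonneg).1

open scoped Matrix.Norms.L2Operator in
theorem inv_add_smul_one_le {A B : Matrix ι ι ℂ} (hA : A.PosSemidef) (hAB : A ≤ B)
    {ε : ℝ} (hε : 0 < ε) : (B + (ε : ℂ) • 1)⁻¹ ≤ (A + (ε : ℂ) • 1)⁻¹ := by
  rw [Matrix.nonsing_inv_eq_ringInverse, Matrix.nonsing_inv_eq_ringInverse]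
  exact CStarAlgebra.ringInverse_le_ringInverse (add_le_add_left hAB _)
    (Matrix.isStrictlyPositive_iff_posDef.mpr (posDef_add_smul_one hA hε))

open scoped Matrix.Norms.L2Operator in
theorem sqrt_mono {A B : Matrix ι ι ℂ} (h : A ≤ B) : CFC.sqrt A ≤ CFC.sqrt B :=
  CFC.sqrt_le_sqrt A B h

/-- `tr ((S + ε)⁻¹ S²) ≤ tr S`. -/
theorem trace_inv_mul_sq_le {S : Matrix ι ι ℂ} (hS : S.PosSemidef) {ε : ℝ} (hε : 0 < ε) :
    ((S + (ε : ℂ) • 1)⁻¹ * (S * S)).trace.re ≤ S.trace.re := by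
  have hd := posDef_add_smul_one hS hε
  have hp := trace_mul_re_nonneg hd.inv.posSemidef hS
  have e : (S + (ε : ℂ) • 1)⁻¹ * (S * S) + (ε : ℂ) • ((S + (ε : ℂ) • 1)⁻¹ * S) = S := by
    rw [← Matrix.mul_smul, ← Matrix.mul_add]
    have : S * S + (ε : ℂ) • S = (S + (ε : ℂ) • 1) * S := by
      rw [Matrix.add_mul, Matrix.smul_mul, Matrix.one_mul]
    rw [this, ← Matrix.mul_assoc,
      Matrix.nonsing_inv_mul _ ((Matrix.isUnit_iff_isUnit_det _).mp hd.isUnit), Matrix.one_mul]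
  have e' := congrArg (fun M : Matrix ι ι ℂ => M.trace.re) e
  simp only [Matrix.trace_add, Matrix.trace_smul, Complex.add_re, smul_eq_mul,
    Complex.re_ofReal_mul] at e'
  nlinarith [mul_nonneg hε.le hp]

/-- `tr S - ε dim ≤ tr ((S + ε)⁻¹ S²)`. -/
theorem le_trace_inv_mul_sq {S : Matrix ι ι ℂ} (hS : S.PosSemidef) {ε : ℝ} (hε : 0 < ε) :
    S.trace.re - ε * Fintype.card ι ≤ ((S + (ε : ℂ) • 1)⁻¹ * (S * S)).trace.re := by
  have hd := posDef_add_smul_one hS hε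
  have hp := (Complex.nonneg_iff.mp hd.inv.posSemidef.trace_nonneg).1
  have e : (S + (ε : ℂ) • 1)⁻¹ * (S * S) =
      S - (ε : ℂ) • 1 + ((ε ^ 2 : ℝ) : ℂ) • (S + (ε : ℂ) • 1)⁻¹ := by
    have hu := (Matrix.isUnit_iff_isUnit_det _).mp hd.isUnit
    have : S * S = (S + (ε : ℂ) • 1) * (S - (ε : ℂ) • 1) + ((ε ^ 2 : ℝ) : ℂ) • 1 := by
      simp only [Matrix.add_mul, Matrix.mul_sub, Matrix.smul_mul, Matrix.mul_smul, Matrix.one_mul,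
        Matrix.mul_one, smul_add, smul_smul, pow_two, Complex.ofReal_mul]
      abel
    rw [this, Matrix.mul_add, ← Matrix.mul_assoc, Matrix.nonsing_inv_mul _ hu, Matrix.one_mul,
      Matrix.mul_smul, Matrix.mul_one]
  have e' := congrArg (fun M : Matrix ι ι ℂ => M.trace.re) e
  simp only [Matrix.trace_add, Matrix.trace_sub, Matrix.trace_smul, Matrix.trace_one,
    Complex.add_re, Complex.sub_re, smul_eq_mul, Complex.re_ofReal_mul, Complex.natCast_re] at e'
  nlinarith [mul_nonneg (sq_nonneg ε) hp]

/-- The trace of the square root is subadditive on positive semidefinite matrices. -/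
theorem trace_sqrt_add_le {A B : Matrix ι ι ℂ} (hA : A.PosSemidef) (hB : B.PosSemidef) :
    (CFC.sqrt (A + B)).trace.re ≤ (CFC.sqrt A).trace.re + (CFC.sqrt B).trace.re := by
  -- With `S = √(A + B)`, operator monotonicity gives `√X ≤ S`, and inversion reverses the order.
  -- The shift by `ε` handles singular `S`. Taking `X = A` and `X = B` splits `tr ((S + ε)⁻¹ S²)`.
  have key : ∀ {X : Matrix ι ι ℂ}, X.PosSemidef → X ≤ A + B → ∀ ε : ℝ, 0 < ε →
      ((CFC.sqrt (A + B) + (ε : ℂ) • 1)⁻¹ * X).trace.re ≤ (CFC.sqrt X).trace.re := by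
    intro X hX hle ε hε
    have h1 := inv_add_smul_one_le (posSemidef_sqrt X) (sqrt_mono hle) hε
    have h2 := trace_mul_re_nonneg (Matrix.le_iff.mp h1) hX
    have h3 := trace_inv_mul_sq_le (posSemidef_sqrt X) hε
    rw [sqrt_mul_sqrt_of_posSemidef hX] at h3
    rw [Matrix.sub_mul, Matrix.trace_sub, Complex.sub_re] at h2
    linarith
  have main : ∀ ε : ℝ, 0 < ε → (CFC.sqrt (A + B)).trace.re ≤
      (CFC.sqrt A).trace.re + (CFC.sqrt B).trace.re + ε * Fintype.card ι := by
    intro ε hε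
    have h1 := le_trace_inv_mul_sq (posSemidef_sqrt (A + B)) hε
    rw [sqrt_mul_sqrt_of_posSemidef (hA.add hB), Matrix.mul_add, Matrix.trace_add,
      Complex.add_re] at h1
    have h2 := key hA (le_add_of_nonneg_right hB.nonneg) ε hε
    have h3 := key hB (le_add_of_nonneg_left hA.nonneg) ε hε
    linarith
  refine le_of_forall_pos_le_add fun δ hδ => ?_
  -- The `+ 1` keeps the denominator positive when `ι` is empty.
  have h := main (δ / (Fintype.card ι + 1)) (by positivity)
  have : δ / (Fintype.card ι + 1) * Fintype.card ι ≤ δ := by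
    rw [div_mul_eq_mul_div, div_le_iff₀ (by positivity)]
    nlinarith
  linarith

theorem trace_sqrt_sum_le {κ : Type*} (s : Finset κ) (A : κ → Matrix ι ι ℂ)
    (hA : ∀ k ∈ s, (A k).PosSemidef) :
    (CFC.sqrt (∑ k ∈ s, A k)).trace.re ≤ ∑ k ∈ s, (CFC.sqrt (A k)).trace.re := by
  classical
  induction s using Finset.induction_on with
  | empty => simp
  | insert k s hk ih =>
    rw [Finset.sum_insert hk, Finset.sum_insert hk]
    have hs : ∀ j ∈ s, (A j).PosSemidef := fun j hj => hA j (Finset.mem_insert_of_mem hj)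
    exact (trace_sqrt_add_le (hA k (Finset.mem_insert_self k s))
      (Matrix.posSemidef_sum s hs)).trans (by gcongr; exact ih hs)

theorem sqrt_smul_of_nonneg {A : Matrix ι ι ℂ} (hA : A.PosSemidef) {p : ℝ} (hp : 0 ≤ p) :
    CFC.sqrt (p • A) = √p • CFC.sqrt A := by
  refine CFC.sqrt_unique ?_ ((posSemidef_sqrt A).smul (Real.sqrt_nonneg p)).nonneg
  rw [Matrix.smul_mul, Matrix.mul_smul, smul_smul, Real.mul_self_sqrt hp,
    sqrt_mul_sqrt_of_posSemidef hA]

/-- The trace of the root depends only on the eigenvalues. Applied to `A Aᴴ` and `Aᴴ A`, this makes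
the trace norm invariant under the adjoint, hence the fidelity symmetric. -/
theorem trace_sqrt_congr_charpoly {A B : Matrix ι ι ℂ} (hA : A.PosSemidef) (hB : B.PosSemidef)
    (h : A.charpoly = B.charpoly) : (CFC.sqrt A).trace = (CFC.sqrt B).trace := by
  have he := (Matrix.IsHermitian.eigenvalues_eq_eigenvalues_iff hA.isHermitian
    hB.isHermitian).mpr h
  rw [CFC.sqrt_eq_real_sqrt A hA.nonneg, CFC.sqrt_eq_real_sqrt B hB.nonneg,
    cfcₙ_eq_cfc, cfcₙ_eq_cfc, Matrix.trace_eq_neg_charpoly_nextCoeff,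
    Matrix.trace_eq_neg_charpoly_nextCoeff, hA.isHermitian.charpoly_cfc_eq,
    hB.isHermitian.charpoly_cfc_eq, he]

theorem traceNorm_nonneg (A : Matrix ι ι ℂ) : 0 ≤ traceNorm A :=
  (Complex.nonneg_iff.mp (posSemidef_sqrt _).trace_nonneg).1

theorem ofReal_traceNorm (A : Matrix ι ι ℂ) : (traceNorm A : ℂ) = (CFC.sqrt (Aᴴ * A)).trace :=
  Complex.ext rfl (Complex.nonneg_iff.mp (posSemidef_sqrt _).trace_nonneg).2

theorem traceNorm_conjTranspose (A : Matrix ι ι ℂ) : traceNorm Aᴴ = traceNorm A := by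
  unfold traceNorm
  rw [Matrix.conjTranspose_conjTranspose, trace_sqrt_congr_charpoly
    (Matrix.posSemidef_self_mul_conjTranspose A) (Matrix.posSemidef_conjTranspose_mul_self A)
    (Matrix.charpoly_mul_comm _ _)]

theorem fidelity_nonneg (ρ σ : Matrix ι ι ℂ) : 0 ≤ fidelity ρ σ :=
  traceNorm_nonneg _

theorem fidelity_comm (ρ σ : Matrix ι ι ℂ) : fidelity ρ σ = fidelity σ ρ := by
  unfold fidelity
  rw [← traceNorm_conjTranspose, Matrix.conjTranspose_mul, (posSemidef_sqrt ρ).isHermitian.eq,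
    (posSemidef_sqrt σ).isHermitian.eq]

theorem fidelity_eq_trace_sqrt {ρ : Matrix ι ι ℂ} (hρ : ρ.PosSemidef) (σ : Matrix ι ι ℂ) :
    fidelity ρ σ = (CFC.sqrt (CFC.sqrt σ * ρ * CFC.sqrt σ)).trace.re := by
  unfold fidelity traceNorm
  rw [Matrix.conjTranspose_mul, (posSemidef_sqrt ρ).isHermitian.eq,
    (posSemidef_sqrt σ).isHermitian.eq, Matrix.mul_assoc, ← Matrix.mul_assoc (CFC.sqrt ρ),
    sqrt_mul_sqrt_of_posSemidef hρ, Matrix.mul_assoc]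

theorem fidelity_sum_left_le {κ : Type*} (s : Finset κ) (p : κ → ℝ) (ρ : κ → Matrix ι ι ℂ)
    (σ : Matrix ι ι ℂ) (hp : ∀ k ∈ s, 0 ≤ p k) (hρ : ∀ k ∈ s, (ρ k).PosSemidef) :
    fidelity (∑ k ∈ s, p k • ρ k) σ ≤ ∑ k ∈ s, √(p k) * fidelity (ρ k) σ := by
  have hc : ∀ k ∈ s, (CFC.sqrt σ * ρ k * CFC.sqrt σ).PosSemidef := fun k hk => by
    simpa only [(posSemidef_sqrt σ).isHermitian.eq] using
      (hρ k hk).conjTranspose_mul_mul_same (CFC.sqrt σ)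
  rw [fidelity_eq_trace_sqrt (Matrix.posSemidef_sum s fun k hk => (hρ k hk).smul (hp k hk)),
    Matrix.mul_sum, Matrix.sum_mul]
  refine (trace_sqrt_sum_le s _ fun k hk => ?_).trans (Finset.sum_le_sum fun k hk => ?_)
  · rw [Matrix.mul_smul, Matrix.smul_mul]
    exact (hc k hk).smul (hp k hk)
  · rw [Matrix.mul_smul, Matrix.smul_mul, sqrt_smul_of_nonneg (hc k hk) (hp k hk),
      Matrix.trace_smul, Complex.real_smul, Complex.re_ofReal_mul,
      fidelity_eq_trace_sqrt (hρ k hk)]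

theorem sum_sqrt_le_sqrt_card {κ : Type*} (s : Finset κ) (p : κ → ℝ) (hp : ∀ k ∈ s, 0 ≤ p k)
    (h1 : ∑ k ∈ s, p k = 1) : ∑ k ∈ s, √(p k) ≤ √(s.card : ℝ) := by
  refine Real.le_sqrt_of_sq_le ?_
  refine (sq_sum_le_card_mul_sum_sq (s := s) (f := fun k => √(p k))).trans_eq ?_
  rw [Finset.sum_congr rfl fun k hk => Real.sq_sqrt (hp k hk), h1, mul_one]

theorem fidelity_le_of_mem_convexHull_left (s : Finset (Matrix ι ι ℂ)) (σ : Matrix ι ι ℂ) {c : ℝ}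
    (hs : ∀ ρ ∈ s, ρ.PosSemidef) (hc : ∀ ρ ∈ s, fidelity ρ σ ≤ c) {τ : Matrix ι ι ℂ}
    (hτ : τ ∈ convexHull ℝ (s : Set (Matrix ι ι ℂ))) : fidelity τ σ ≤ √(s.card : ℝ) * c := by
  obtain ⟨p, hp, h1, rfl⟩ := Finset.mem_convexHull'.mp hτ
  -- Weights summing to 1 need a nonempty index set; any point of it forces `0 ≤ c`.
  have hne : s.Nonempty := by
    rw [Finset.nonempty_iff_ne_empty]
    rintro rfl
    simp at h1
  obtain ⟨ρ₀, hρ₀⟩ := hne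
  have hc0 : 0 ≤ c := (fidelity_nonneg ρ₀ σ).trans (hc ρ₀ hρ₀)
  calc fidelity (∑ ρ ∈ s, p ρ • ρ) σ ≤ ∑ ρ ∈ s, √(p ρ) * fidelity ρ σ :=
        fidelity_sum_left_le s p id σ hp hs
    _ ≤ ∑ ρ ∈ s, √(p ρ) * c :=
        Finset.sum_le_sum fun ρ hρ => mul_le_mul_of_nonneg_left (hc ρ hρ) (Real.sqrt_nonneg _)
    _ ≤ √(s.card : ℝ) * c := by
        rw [← Finset.sum_mul]
        exact mul_le_mul_of_nonneg_right (sum_sqrt_le_sqrt_card s p hp h1) hc0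

/-- Fidelity of two mixtures of at most `card s` and `card t` positive semidefinite matrices. -/
theorem fidelity_le_of_mem_convexHull (s t : Finset (Matrix ι ι ℂ)) {c : ℝ}
    (hs : ∀ ρ ∈ s, ρ.PosSemidef) (ht : ∀ σ ∈ t, σ.PosSemidef)
    (hc : ∀ ρ ∈ s, ∀ σ ∈ t, fidelity ρ σ ≤ c) {τ₁ τ₂ : Matrix ι ι ℂ}
    (h₁ : τ₁ ∈ convexHull ℝ (s : Set (Matrix ι ι ℂ)))
    (h₂ : τ₂ ∈ convexHull ℝ (t : Set (Matrix ι ι ℂ))) :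
    fidelity τ₁ τ₂ ≤ √((s.card : ℝ) * t.card) * c := by
  rw [Real.sqrt_mul (Nat.cast_nonneg _), mul_assoc]
  -- The one-sided bound is applied twice: the inner use, with the arguments swapped, supplies the
  -- constant `√(card t) * c`.
  refine fidelity_le_of_mem_convexHull_left s τ₂ hs (fun ρ hρ => ?_) h₁
  rw [fidelity_comm]
  refine fidelity_le_of_mem_convexHull_left t ρ ht (fun σ hσ => ?_) h₂
  rw [fidelity_comm]
  exact hc ρ hρ σ hσ

theorem fidelity_le_supFidelity {S T : Set (Matrix ι ι ℂ)} (hS : S.Finite) (hT : T.Finite)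
    {ρ σ : Matrix ι ι ℂ} (hρ : ρ ∈ S) (hσ : σ ∈ T) : fidelity ρ σ ≤ supFidelity S T := by
  refine le_csSup (Set.Finite.bddAbove ?_) ⟨ρ, hρ, σ, hσ, rfl⟩
  refine (hS.image2 fidelity hT).subset ?_
  rintro x ⟨ρ, hρ, σ, hσ, rfl⟩
  exact ⟨ρ, hρ, σ, hσ, rfl⟩

theorem supFidelity_nonneg (S T : Set (Matrix ι ι ℂ)) : 0 ≤ supFidelity S T := by
  refine Real.sSup_nonneg ?_
  rintro x ⟨ρ, -, σ, -, rfl⟩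
  exact fidelity_nonneg ρ σ

end Trace

/-! ### Tensor powers and multiplicativity of the fidelity -/

section TensorPow

variable {d : ℕ} (n : ℕ)

theorem tensorPow_mul (A B : Matrix (Fin d) (Fin d) ℂ) :
    tensorPow n (A * B) = tensorPow n A * tensorPow n B := by
  ext a b
  simp only [tensorPow, Matrix.of_apply, Matrix.mul_apply, ← Finset.prod_mul_distrib]
  rw [Finset.prod_univ_sum, Fintype.piFinset_univ]

theorem tensorPow_conjTranspose (A : Matrix (Fin d) (Fin d) ℂ) :
    tensorPow n Aᴴ = (tensorPow n A)ᴴ := by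
  ext a b
  simp [tensorPow, Matrix.conjTranspose_apply]

theorem trace_tensorPow (A : Matrix (Fin d) (Fin d) ℂ) :
    (tensorPow n A).trace = A.trace ^ n := by
  simp only [Matrix.trace, Matrix.diag_apply, tensorPow, Matrix.of_apply]
  rw [Finset.sum_pow', Fintype.piFinset_univ]

variable {n}

theorem posSemidef_tensorPow {A : Matrix (Fin d) (Fin d) ℂ} (hA : A.PosSemidef) :
    (tensorPow n A).PosSemidef := by
  have h := Matrix.posSemidef_conjTranspose_mul_self (tensorPow n (CFC.sqrt A))
  rwa [← tensorPow_conjTranspose, ← tensorPow_mul, (posSemidef_sqrt A).isHermitian.eq,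
    sqrt_mul_sqrt_of_posSemidef hA] at h

theorem sqrt_tensorPow {A : Matrix (Fin d) (Fin d) ℂ} (hA : A.PosSemidef) :
    CFC.sqrt (tensorPow n A) = tensorPow n (CFC.sqrt A) := by
  refine CFC.sqrt_unique ?_ (posSemidef_tensorPow (posSemidef_sqrt A)).nonneg
  rw [← tensorPow_mul, sqrt_mul_sqrt_of_posSemidef hA]

theorem traceNorm_tensorPow (A : Matrix (Fin d) (Fin d) ℂ) :
    traceNorm (tensorPow n A) = traceNorm A ^ n := by
  apply Complex.ofReal_injective
  rw [Complex.ofReal_pow, ofReal_traceNorm, ofReal_traceNorm, ← tensorPow_conjTranspose,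
    ← tensorPow_mul, sqrt_tensorPow (Matrix.posSemidef_conjTranspose_mul_self A), trace_tensorPow]

theorem fidelity_tensorPow {ρ σ : Matrix (Fin d) (Fin d) ℂ} (hρ : ρ.PosSemidef)
    (hσ : σ.PosSemidef) :
    fidelity (tensorPow n ρ) (tensorPow n σ) = fidelity ρ σ ^ n := by
  unfold fidelity
  rw [sqrt_tensorPow hρ, sqrt_tensorPow hσ, ← tensorPow_mul, traceNorm_tensorPow]

/-- Only `≤` holds: distinct states can share a tensor power, as when `n = 0`. -/
theorem exists_finset_coe_eq_copies {D : Set (Matrix (Fin d) (Fin d) ℂ)} {m : ℕ}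
    (hm : D.encard = m) :
    ∃ s : Finset (Matrix (Fin n → Fin d) (Fin n → Fin d) ℂ), (s : Set _) = copies n D ∧
      s.card ≤ m := by
  have hf : (copies n D).Finite := (Set.finite_of_encard_eq_coe hm).image _
  refine ⟨hf.toFinset, hf.coe_toFinset, ?_⟩
  have h : (copies n D).encard ≤ m := hm ▸ Set.encard_image_le _ _
  rw [hf.encard_eq_coe_toFinset_card] at h
  exact_mod_cast h

theorem fidelity_le_of_mem_mixtures {m₁ m₂ : ℕ} {D₁ D₂ : Set (Matrix (Fin d) (Fin d) ℂ)}
    (hD₁ : ∀ ρ ∈ D₁, ρ.PosSemidef) (hD₂ : ∀ ρ ∈ D₂, ρ.PosSemidef)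
    (hm₁ : D₁.encard = m₁) (hm₂ : D₂.encard = m₂)
    {σ₁ σ₂ : Matrix (Fin n → Fin d) (Fin n → Fin d) ℂ}
    (h₁ : σ₁ ∈ mixtures n D₁) (h₂ : σ₂ ∈ mixtures n D₂) :
    fidelity σ₁ σ₂ ≤ √((m₁ : ℝ) * (m₂ : ℝ)) * supFidelity D₁ D₂ ^ n := by
  obtain ⟨s, hs, hsm⟩ := exists_finset_coe_eq_copies (n := n) hm₁
  obtain ⟨t, ht, htm⟩ := exists_finset_coe_eq_copies (n := n) hm₂
  have hs' : ∀ τ ∈ s, ∃ ρ ∈ D₁, tensorPow n ρ = τ := fun τ hτ => by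
    rw [← Finset.mem_coe, hs] at hτ; exact hτ
  have ht' : ∀ τ ∈ t, ∃ ρ ∈ D₂, tensorPow n ρ = τ := fun τ hτ => by
    rw [← Finset.mem_coe, ht] at hτ; exact hτ
  have hF := pow_nonneg (supFidelity_nonneg D₁ D₂) n
  calc fidelity σ₁ σ₂ ≤ √((s.card : ℝ) * t.card) * supFidelity D₁ D₂ ^ n := by
        refine fidelity_le_of_mem_convexHull s t ?_ ?_ ?_ (hs ▸ h₁) (ht ▸ h₂)
        · intro τ hτ
          obtain ⟨ρ, hρ, rfl⟩ := hs' τ hτ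
          exact posSemidef_tensorPow (hD₁ ρ hρ)
        · intro τ hτ
          obtain ⟨ρ, hρ, rfl⟩ := ht' τ hτ
          exact posSemidef_tensorPow (hD₂ ρ hρ)
        · intro τ hτ τ' hτ'
          obtain ⟨ρ, hρ, rfl⟩ := hs' τ hτ
          obtain ⟨σ, hσ, rfl⟩ := ht' τ' hτ'
          rw [fidelity_tensorPow (hD₁ ρ hρ) (hD₂ σ hσ)]
          exact pow_le_pow_left₀ (fidelity_nonneg ρ σ) (fidelity_le_supFidelity
            (Set.finite_of_encard_eq_coe hm₁) (Set.finite_of_encard_eq_coe hm₂) hρ hσ) n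
    _ ≤ √((m₁ : ℝ) * (m₂ : ℝ)) * supFidelity D₁ D₂ ^ n := by gcongr

end TensorPow

end QState

theorem mainTheorem8 (d n m₁ m₂ : ℕ) (D₁ D₂ : Set (Matrix (Fin d) (Fin d) ℂ))
    (hD₁ : ∀ ρ ∈ D₁, QState.IsDensityMatrix ρ) (hD₂ : ∀ ρ ∈ D₂, QState.IsDensityMatrix ρ)
    (hm₁ : D₁.encard = m₁) (hm₂ : D₂.encard = m₂) :
    (∀ σ₁ ∈ QState.mixtures n D₁, ∀ σ₂ ∈ QState.mixtures n D₂,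
      QState.fidelity σ₁ σ₂ ≤ √((m₁ : ℝ) * (m₂ : ℝ)) * QState.supFidelity D₁ D₂ ^ n) ∧
    QState.supFidelity (QState.mixtures n D₁) (QState.mixtures n D₂) ≤
      √((m₁ : ℝ) * (m₂ : ℝ)) * QState.supFidelity D₁ D₂ ^ n := by
  have h := fun σ₁ h₁ σ₂ h₂ => QState.fidelity_le_of_mem_mixtures (n := n) (σ₁ := σ₁) (σ₂ := σ₂)
    (fun ρ hρ => (hD₁ ρ hρ).1) (fun ρ hρ => (hD₂ ρ hρ).1) hm₁ hm₂ h₁ h₂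
  -- The bound must be nonnegative because `sSup ∅ = 0` when some `Dᵢ` is empty.
  refine ⟨h, Real.sSup_le ?_ (mul_nonneg (Real.sqrt_nonneg _)
    (pow_nonneg (QState.supFidelity_nonneg D₁ D₂) n))⟩
  rintro x ⟨σ₁, h₁, σ₂, h₂, rfl⟩
  exact h σ₁ h₁ σ₂ h₂
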